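/- Let $SL_2(\mathbb Z)$ act on $M=\mathbb Z[x,y]$ by ring automorphisms extending its natural action on $\mathbb Z^2=\mathbb Zx\oplus\mathbb Zy$, so that $\begin{pmatrix}1&0\\-1&1\end{pmatrix}$ sends $x\mapsto x-y,\ y\mapsto y$ and $\begin{pmatrix}1&1\\0&1\end{pmatrix}$ sends $x\mapsto x,\ y\mapsto x+y$. For a positive integer $m$ let $\Gamma(m)=\ker\bigl(SL_2(\mathbb Z)\to SL_2(\mathbb Z/m)\bigr)$ be the principal congruence subgroup of level $m$. Let $p$ be a prime number, let $a\le b$ be positive integers, and let $m$ be a positive integer with $p^a\mid m$ and $p^{a+1}\nmid m$. Then the module $$H^0\bigl(\Gamma(m);M\otimes\mathbb Z/p^b\bigr)=\bigl((\mathbb Z/p^b)[x,y]\bigr)^{\Gamma(m)}$$ is generated, as a $\mathbb Z/p^b$-module, by the set of all (reductions mod $p^b$ of) polynomials of the form $$c\,P(x^d,y^d),$$ where $P\in\mathbb Z[x,y]$ is arbitrary and $c,d$ are positive integers such that $p^{b-a}$ divides the product $cd$. That is, all these polynomials are $\Gamma(m)$-invariant modulo $p^b$, and they generate the module of invariants.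 -/

import Mathlib

open scoped MatrixGroups TensorProduct

namespace StdSym

noncomputable section

/-- The ring `M = ℤ[x, y]`, where `x = X 0` and `y = X 1`. -/
abbrev M : Type := MvPolynomial (Fin 2) ℤ

/-- The action on `M = ℤ[x, y]` of an integral `2 × 2` matrix `g`, extending to the symmetric
algebra its natural action on `ℤ² = ℤx ⊕ ℤy`: the variable with index `j` goes to the linear form
whose coefficients are the entries of column `j` of `g`. -/
def subst (g : Matrix (Fin 2) (Fin 2) ℤ) : M →ₐ[ℤ] M :=
  MvPolynomial.aeval fun j => ∑ i, MvPolynomial.C (g i j) * MvPolynomial.X i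

theorem subst_one : subst 1 = AlgHom.id ℤ M := by
  ext j
  fin_cases j <;> simp [subst]

theorem subst_mul (g h : Matrix (Fin 2) (Fin 2) ℤ) :
    subst (g * h) = (subst g).comp (subst h) := by
  ext1 j
  simp [subst, Matrix.mul_apply, Fin.sum_univ_two]
  ring

/-- `M = ℤ[x, y]` as a representation of `SL(2, ℤ)`. -/
def rhoM : Representation ℤ SL(2, ℤ) M where
  toFun g := (subst (g : Matrix (Fin 2) (Fin 2) ℤ)).toLinearMap
  map_one' := by
    rw [Matrix.SpecialLinearGroup.coe_one, subst_one]
    rfl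
  map_mul' g h := by
    rw [Matrix.SpecialLinearGroup.coe_mul, subst_mul]
    rfl

/-- The `SL(2, ℤ)`-module `M ⊗ ℤ/N`, with `SL(2, ℤ)` acting trivially on `ℤ/N`. -/
def rhoMod (N : ℕ) : Representation ℤ SL(2, ℤ) (M ⊗[ℤ] ZMod N) :=
  rhoM.tprod (Representation.trivial ℤ SL(2, ℤ) (ZMod N))

/-- `M ⊗ ℤ/N` as a module over a subgroup `G` of `SL(2, ℤ)`. -/
abbrev coeff (G : Subgroup SL(2, ℤ)) (N : ℕ) : Rep.{0} ℤ G :=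
  Rep.of ((rhoMod N).comp G.subtype)

/-- The canonical map from the group cohomology `H⁰(G; M ⊗ ℤ/N)` to `M ⊗ ℤ/N`: the canonical
isomorphism with the invariants, followed by their inclusion. -/
def H0Incl (G : Subgroup SL(2, ℤ)) (N : ℕ) :
    groupCohomology (coeff G N) 0 →ₗ[ℤ] M ⊗[ℤ] ZMod N :=
  (coeff G N).ρ.invariants.subtype ∘ₗ (groupCohomology.H0Iso (coeff G N)).hom.hom

theorem H0Incl_injective (G : Subgroup SL(2, ℤ)) (N : ℕ) : Function.Injective (H0Incl G N) :=
  Subtype.val_injective.comp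
    (groupCohomology.H0Iso (coeff G N)).toLinearEquiv.injective

/-- `H⁰(G; M ⊗ ℤ/N)` as a submodule of `M ⊗ ℤ/N`, through the injective map `H0Incl`. -/
def H0 (G : Subgroup SL(2, ℤ)) (N : ℕ) : Submodule ℤ (M ⊗[ℤ] ZMod N) :=
  LinearMap.range (H0Incl G N)

theorem mem_H0 (G : Subgroup SL(2, ℤ)) (N : ℕ) (f : M ⊗[ℤ] ZMod N) :
    f ∈ H0 G N ↔ ∀ g ∈ G, rhoMod N g f = f := by
  constructor
  · rintro ⟨h, rfl⟩ g hg
    exact ((groupCohomology.H0Iso (coeff G N)).hom.hom h).2 ⟨g, hg⟩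
  · intro hf
    obtain ⟨h, hh⟩ := (groupCohomology.H0Iso (coeff G N)).toLinearEquiv.surjective
      ⟨f, fun g => hf g g.2⟩
    exact ⟨h, congrArg Subtype.val hh⟩

/-- The polynomial `c P(x ^ d, y ^ d)` of `M ⊗ ℤ/N`. -/
def dilated (N c d : ℕ) (P : M) : M ⊗[ℤ] ZMod N :=
  (c • MvPolynomial.aeval (fun i => (MvPolynomial.X i : M) ^ d) P) ⊗ₜ[ℤ] (1 : ZMod N)

end

end StdSym

namespace StdSym

open MvPolynomial TensorProduct

/-! Invariance of the generators: an element of `Γ(m)` moves each variable by a multiple of `p ^ a`,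
and every factor `p` of `d` gains one more `p` in the difference of `d`-th powers
(`pow_dvd_pow_sub_pow`); the factor `c` supplies the rest.

Conversely, invariance under the two elementary matrices with off-diagonal entry `m` already
suffices. Comparing coefficients forces `p ^ b` to divide both `m * u * z` and `m * v * z` for each
term `z x^u y^v` (`dvd_mul_coeff_of_dvd_subst_transvection`). As `m` has `p`-adic valuation exactly
`a`, `p ^ (b - a)` divides `gcd(u, v) * z`, so each term is itself a generator with `d = gcd(u, v)`.
-/

/-- Factor `S ^ p - T ^ p` as `S - T` times a geometric sum; since `a > 0` gives `S ≡ T` mod `p`,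
that sum is `p * T ^ (p - 1) ≡ 0` mod `p`. -/
theorem pow_dvd_pow_sub_pow {R : Type*} [CommRing R] (p : ℕ) {a : ℕ} (ha : 0 < a) {A B : R}
    (h : (p : R) ^ a ∣ A - B) {k d : ℕ} (hd : p ^ k ∣ d) :
    (p : R) ^ (a + k) ∣ A ^ d - B ^ d := by
  obtain ⟨e, rfl⟩ := hd
  rw [pow_mul, pow_mul]
  refine Dvd.dvd.trans ?_ (sub_dvd_pow_sub_pow _ _ e)
  induction k with
  | zero => simpa using h
  | succ k ih =>
    rw [← add_assoc, pow_succ p k, pow_mul, pow_mul]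
    set S := A ^ p ^ k
    set T := B ^ p ^ k
    have hp : (p : R) ∣ S - T := (dvd_pow_self _ (by omega)).trans ih
    rw [← (Commute.all S T).geom_sum₂_mul, pow_succ']
    refine mul_dvd_mul ?_ ih
    obtain ⟨w, hw⟩ := hp
    rw [show S = T + p * w by rw [← hw]; ring]
    rw [← Ideal.mem_span_singleton, ← Ideal.Quotient.eq_zero_iff_mem]
    have hz : Ideal.Quotient.mk (Ideal.span {(p : R)}) (p : R) = 0 :=
      Ideal.Quotient.eq_zero_iff_mem.2 (Ideal.mem_span_singleton_self _)
    simp only [map_sum, map_mul, map_pow, map_add, hz, zero_mul, add_zero]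
    rw [geom_sum₂_self]
    rw [map_natCast] at hz
    rw [hz, zero_mul]

theorem dvd_aeval_sub_aeval {σ R : Type*} [CommRing R] {q : R} {f g : σ → R}
    (h : ∀ i, q ∣ f i - g i) (P : MvPolynomial σ ℤ) : q ∣ aeval f P - aeval g P := by
  have hfg : ∀ i, Ideal.Quotient.mk (Ideal.span {q}) (f i) =
      Ideal.Quotient.mk (Ideal.span {q}) (g i) := fun i =>
    (Ideal.Quotient.eq).2 (Ideal.mem_span_singleton.2 (h i))
  rw [← Ideal.mem_span_singleton, ← Ideal.Quotient.eq]
  induction P using MvPolynomial.induction_on with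
  | C a => simp
  | add P Q hP hQ => simp [hP, hQ]
  | mul_X P i hP => simp [hP, hfg]

theorem tmul_one_eq_zero_iff (N : ℕ) (P : M) :
    P ⊗ₜ[ℤ] (1 : ZMod N) = 0 ↔ (N : M) ∣ P := by
  constructor
  · intro h
    have hc : (C (N : ℤ) : M) ∣ P := by
      rw [C_dvd_iff_dvd_coeff]
      intro s
      have := congrArg ((TensorProduct.lid ℤ (ZMod N)).toLinearMap ∘ₗ
        LinearMap.rTensor (ZMod N) (MvPolynomial.lcoeff ℤ s)) h
      simpa [ZMod.intCast_zmod_eq_zero_iff_dvd] using this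
    simpa using hc
  · rintro ⟨Q, rfl⟩
    have : (N : M) * Q = (N : ℤ) • Q := by simp
    rw [this, TensorProduct.smul_tmul]
    simp

theorem exists_tmul_one (N : ℕ) (F : M ⊗[ℤ] ZMod N) : ∃ P : M, F = P ⊗ₜ[ℤ] (1 : ZMod N) := by
  induction F using TensorProduct.induction_on with
  | zero => exact ⟨0, by simp⟩
  | tmul P z =>
    obtain ⟨n, rfl⟩ := ZMod.intCast_surjective z
    refine ⟨n • P, ?_⟩
    rw [TensorProduct.smul_tmul]
    simp
  | add F G hF hG =>
    obtain ⟨P, rfl⟩ := hF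
    obtain ⟨Q, rfl⟩ := hG
    exact ⟨P + Q, by rw [TensorProduct.add_tmul]⟩

theorem tmul_one_mem_H0_iff (G : Subgroup SL(2, ℤ)) (N : ℕ) (P : M) :
    P ⊗ₜ[ℤ] (1 : ZMod N) ∈ H0 G N ↔ ∀ g ∈ G, (N : M) ∣ subst g.1 P - P := by
  rw [mem_H0]
  refine forall₂_congr fun g _ => ?_
  rw [← tmul_one_eq_zero_iff, TensorProduct.sub_tmul, sub_eq_zero]
  rfl

theorem dvd_subst_X_sub_X {m : ℕ} {g : SL(2, ℤ)} (hg : g ∈ CongruenceSubgroup.Gamma m)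
    (j : Fin 2) : (m : M) ∣ subst g.1 (X j) - X j := by
  have key : ∀ z : ℤ, (z : ZMod m) = 0 → (m : M) ∣ C z := fun z hz => by
    simpa using (map_dvd (C : ℤ →+* M) ((ZMod.intCast_zmod_eq_zero_iff_dvd z m).1 hz))
  obtain ⟨h00, h01, h10, h11⟩ := CongruenceSubgroup.Gamma_mem.1 hg
  have e00 := key (g 0 0 - 1) (by simp [h00])
  have e01 := key (g 0 1) h01
  have e10 := key (g 1 0) h10
  have e11 := key (g 1 1 - 1) (by simp [h11])
  fin_cases j
  · have : subst g.1 (X 0) - X 0 = C (g 0 0 - 1) * X 0 + C (g 1 0) * X 1 := by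
      simp [subst]; ring
    exact this ▸ dvd_add (e00.mul_right _) (e10.mul_right _)
  · have : subst g.1 (X 1) - X 1 = C (g 0 1) * X 0 + C (g 1 1 - 1) * X 1 := by
      simp [subst]; ring
    exact this ▸ dvd_add (e01.mul_right _) (e11.mul_right _)

theorem dilated_mem_H0 {p : ℕ} (hp : p.Prime) {a b m : ℕ} (ha : 0 < a) (hab : a ≤ b)
    (hdvd : p ^ a ∣ m) {c d : ℕ} (hcd : p ^ (b - a) ∣ c * d) (P : M) :
    dilated (p ^ b) c d P ∈ H0 (CongruenceSubgroup.Gamma m) (p ^ b) := by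
  rw [dilated, tmul_one_mem_H0_iff]
  intro g hg
  -- Split `p ^ (b - a)` as `p ^ l * p ^ k` with `p ^ l ∣ c` and `p ^ k ∣ d`.
  obtain ⟨q, r, hq, hr, hqr⟩ := (Nat.dvd_mul).1 hcd
  obtain ⟨l, -, rfl⟩ := (Nat.dvd_prime_pow hp).1 (Dvd.intro _ hqr)
  obtain ⟨k, -, rfl⟩ := (Nat.dvd_prime_pow hp).1 (Dvd.intro_left _ hqr)
  rw [← pow_add] at hqr
  have hlk : l + k = b - a := Nat.pow_right_injective hp.two_le hqr
  have hX : ∀ i : Fin 2, (p : M) ^ (a + k) ∣ subst g.1 (X i) ^ d - X i ^ d := fun i =>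
    pow_dvd_pow_sub_pow p ha
      (Dvd.dvd.trans (by exact_mod_cast Nat.cast_dvd_cast hdvd) (dvd_subst_X_sub_X hg i)) hr
  have hP := dvd_aeval_sub_aeval hX P
  have hs : subst g.1 (c • aeval (fun i => (X i : M) ^ d) P) =
      c • aeval (fun i => subst g.1 (X i) ^ d) P := by
    rw [map_nsmul]
    congr 1
    rw [← AlgHom.comp_apply, comp_aeval]
    simp
  rw [hs, ← smul_sub, nsmul_eq_mul, Nat.cast_pow, show b = l + (a + k) by omega, pow_add]
  refine mul_dvd_mul ?_ hP
  exact_mod_cast Nat.cast_dvd_cast hq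

/-- The exponent of `X i ^ u * X j ^ v`. -/
noncomputable def expo (i j : Fin 2) (u v : ℕ) : Fin 2 →₀ ℕ := Finsupp.single i u + Finsupp.single j v

theorem expo_inj {i j : Fin 2} (hij : i ≠ j) {u v r s : ℕ} :
    expo i j u v = expo i j r s ↔ u = r ∧ v = s := by
  constructor
  · intro h
    have h1 := DFunLike.congr_fun h i
    have h2 := DFunLike.congr_fun h j
    simpa [expo, hij, hij.symm, Finsupp.single_apply] using And.intro h1 h2
  · rintro ⟨rfl, rfl⟩; rfl

theorem eq_expo {i j : Fin 2} (hij : i ≠ j) (s : Fin 2 →₀ ℕ) : s = expo i j (s i) (s j) := by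
  ext k
  have : k = i ∨ k = j := by omega
  rcases this with rfl | rfl <;> simp [expo, hij, hij.symm]

theorem monomial_expo (i j : Fin 2) (u v : ℕ) (z : ℤ) :
    (monomial (expo i j u v) z : M) = C z * (X i ^ u * X j ^ v) := by
  rw [expo, X_pow_eq_monomial, X_pow_eq_monomial, monomial_mul, C_mul_monomial]
  simp

theorem subst_transvection_self {i j : Fin 2} (hij : i ≠ j) (t : ℤ) :
    subst (Matrix.transvection i j t) (X i) = X i := by
  fin_cases i <;> fin_cases j <;> simp_all [subst, Matrix.transvection, Matrix.single]

theorem subst_transvection_other {i j : Fin 2} (hij : i ≠ j) (t : ℤ) :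
    subst (Matrix.transvection i j t) (X j) = C t * X i + X j := by
  fin_cases i <;> fin_cases j <;> simp_all [subst, Matrix.transvection, Matrix.single, add_comm]

theorem coeff_subst_transvection {i j : Fin 2} (hij : i ≠ j) (t : ℤ) (f : M) (u v : ℕ) :
    MvPolynomial.coeff (expo i j u v) (subst (Matrix.transvection i j t) f) =
      ∑ k ∈ Finset.range (u + 1),
        ((v + k).choose k : ℤ) * t ^ k * MvPolynomial.coeff (expo i j (u - k) (v + k)) f := by
  induction f using MvPolynomial.induction_on' with
  | add f g hf hg => simp [hf, hg, mul_add, Finset.sum_add_distrib]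
  | monomial e z =>
    obtain ⟨r, s, rfl⟩ : ∃ r s, e = expo i j r s := ⟨_, _, eq_expo hij e⟩
    have hs : subst (Matrix.transvection i j t) (monomial (expo i j r s) z) =
        ∑ k ∈ Finset.range (s + 1),
          monomial (expo i j (r + k) (s - k)) (z * (t ^ k * s.choose k)) := by
      rw [monomial_expo, ← algebraMap_eq, map_mul, AlgHom.commutes, map_mul, map_pow, map_pow,
        subst_transvection_self hij, subst_transvection_other hij, add_pow, Finset.mul_sum,
        Finset.mul_sum]
      refine Finset.sum_congr rfl fun k _ => ?_
      rw [monomial_expo, algebraMap_eq]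
      simp only [C_mul, C_pow, mul_pow, pow_add, map_natCast]
      ring
    rw [hs, coeff_sum]
    simp only [coeff_monomial, expo_inj hij]
    by_cases h : r ≤ u ∧ r + s = u + v
    · obtain ⟨hru, hrs⟩ := h
      rw [Finset.sum_eq_single (u - r), Finset.sum_eq_single (u - r)]
      · rw [if_pos (by omega), if_pos (by omega), show v + (u - r) = s by omega]; ring
      · intro k hk hne
        rw [if_neg (by simp at hk; omega), mul_zero]
      · intro hk; simp at hk
      · intro k hk hne
        rw [if_neg (by omega)]
      · intro hk; simp at hk; omega
    · rw [Finset.sum_eq_zero, Finset.sum_eq_zero]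
      · intro k hk
        rw [if_neg (by simp at hk; omega), mul_zero]
      · intro k hk
        rw [if_neg (by simp at hk; omega)]

/-- The `p`-adic valuation of `k + 1` is at most `k`, so `t ^ k` makes up for cancelling the factor
`k + 1`. -/
theorem pow_dvd_pow_mul_of_dvd_mul {p : ℕ} (hp : p.Prime) {b k : ℕ} {t T : ℤ}
    (ht : (p : ℤ) ∣ t) (h : (p : ℤ) ^ b ∣ (k + 1 : ℕ) * T) : (p : ℤ) ^ b ∣ t ^ k * T := by
  obtain ⟨v, n, hn, hk⟩ := Nat.exists_eq_pow_mul_and_not_dvd (Nat.succ_ne_zero k) p hp.ne_one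
  have hcop : IsCoprime ((p : ℤ) ^ b) (n : ℤ) :=
    (Nat.isCoprime_iff_coprime.2 ((Nat.Prime.coprime_iff_not_dvd hp).2 hn)).pow_left
  have hvk : v ≤ k := by
    have h1 : v < p ^ v := Nat.lt_pow_self hp.one_lt
    have h2 : p ^ v ≤ k + 1 := Nat.le_of_dvd (Nat.succ_pos k) (Dvd.intro _ hk.symm)
    omega
  have h' : (p : ℤ) ^ b ∣ (p : ℤ) ^ v * T := by
    refine hcop.dvd_of_dvd_mul_left (h.trans (dvd_of_eq ?_))
    rw [← Nat.succ_eq_add_one, hk]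
    push_cast
    ring
  exact h'.trans (mul_dvd_mul_right ((pow_dvd_pow _ hvk).trans (pow_dvd_pow_of_dvd ht k)) T)

/-- Induction on `u` within a fixed total degree: the part of the coefficient linear in `t` is the
wanted product, and the higher powers of `t` vanish mod `p ^ b` by the earlier cases. -/
theorem dvd_mul_coeff_of_dvd_subst_transvection {p : ℕ} (hp : p.Prime) {b : ℕ} {t : ℤ}
    (ht : (p : ℤ) ∣ t) {i j : Fin 2} (hij : i ≠ j) {f : M}
    (hf : ((p ^ b : ℕ) : M) ∣ subst (Matrix.transvection i j t) f - f) (u v : ℕ) :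
    (p : ℤ) ^ b ∣ t * (v * MvPolynomial.coeff (expo i j u v) f) := by
  rcases v with - | v
  · simp
  induction u using Nat.strong_induction_on generalizing v with
  | _ u ih =>
    have hc : (p : ℤ) ^ b ∣
        MvPolynomial.coeff (expo i j (u + 1) v) (subst (Matrix.transvection i j t) f - f) := by
      have h' : (C ((p : ℤ) ^ b) : M) ∣ subst (Matrix.transvection i j t) f - f := by
        simpa using hf
      exact (C_dvd_iff_dvd_coeff _ _).1 h' _
    -- Peel off `k = 0`, which cancels against `f`, and `k = 1`, the wanted term.
    rw [coeff_sub, coeff_subst_transvection hij, Finset.sum_range_succ',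
      Finset.sum_range_succ'] at hc
    have htail : (p : ℤ) ^ b ∣ ∑ k ∈ Finset.range u, ((v + (k + 1 + 1)).choose (k + 1 + 1) : ℤ) *
        t ^ (k + 1 + 1) * MvPolynomial.coeff (expo i j (u + 1 - (k + 1 + 1)) (v + (k + 1 + 1))) f := by
      refine Finset.dvd_sum fun k hk => ?_
      have hI := ih (u + 1 - (k + 1 + 1)) (by simp at hk; omega) (v + (k + 1))
      set z := MvPolynomial.coeff (expo i j (u + 1 - (k + 1 + 1)) (v + (k + 1 + 1))) f
      -- With `K = k + 2`, the identity `(v + K) * choose (v + K - 1) (K - 1) = K * choose (v + K)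
      -- K` trades the factor `v + K` of the induction hypothesis for `K`, which `t ^ (K - 1)`
      -- absorbs.
      have hch : ((v + (k + 1) + 1 : ℕ) : ℤ) * ((v + (k + 1)).choose (k + 1) : ℤ) =
          ((v + (k + 1) + 1).choose (k + 1 + 1) : ℤ) * ((k + 1 + 1 : ℕ) : ℤ) := by
        exact_mod_cast Nat.add_one_mul_choose_eq (v + (k + 1)) (k + 1)
      have hT : (p : ℤ) ^ b ∣ ((k + 1) + 1 : ℕ) *
          (((v + (k + 1 + 1)).choose (k + 1 + 1) : ℤ) * t * z) := by
        refine (hI.mul_left ((v + (k + 1)).choose (k + 1) : ℤ)).trans (dvd_of_eq ?_)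
        rw [← add_assoc v (k + 1) 1]
        linear_combination (t * z) * hch
      refine (pow_dvd_pow_mul_of_dvd_mul hp ht hT).trans (dvd_of_eq ?_)
      ring
    rw [pow_zero, Nat.choose_zero_right, Nat.cast_one, one_mul, one_mul, Nat.sub_zero, add_zero,
      add_sub_cancel_right] at hc
    have hfin := (dvd_add_right htail).1 hc
    refine hfin.trans (dvd_of_eq ?_)
    rw [zero_add, Nat.choose_one_right, pow_one, Nat.add_sub_cancel]
    ring

theorem transvection_mem_Gamma (m : ℕ) {i j : Fin 2} (hij : i ≠ j) :
    ∃ g ∈ CongruenceSubgroup.Gamma m, g.1 = Matrix.transvection i j (m : ℤ) := by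
  refine ⟨Matrix.SpecialLinearGroup.transvection hij (m : ℤ), ?_, rfl⟩
  rw [CongruenceSubgroup.Gamma_mem]
  fin_cases i <;> fin_cases j <;> simp_all [Matrix.SpecialLinearGroup.transvection_coe, Matrix.single]

theorem monomial_tmul_one_mem_span {q N u v : ℕ} (hq : 0 < q) {z : ℤ}
    (hu : (q : ℤ) ∣ u * z) (hv : (q : ℤ) ∣ v * z) :
    (monomial (expo 0 1 u v) z : M) ⊗ₜ[ℤ] (1 : ZMod N) ∈ Submodule.span ℤ
      {f | ∃ (c d : ℕ) (P : M), 0 < c ∧ 0 < d ∧ q ∣ c * d ∧ f = dilated N c d P} := by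
  rcases eq_or_ne z 0 with rfl | hz
  · simp
  refine Submodule.subset_span ?_
  -- A constant term has `gcd = 0`, so there `d = q`. Otherwise `c = |z|`, with the sign moved into
  -- `P` because `c` must be positive.
  rcases Nat.eq_zero_or_pos (u.gcd v) with h0 | hd
  · obtain ⟨rfl, rfl⟩ := Nat.gcd_eq_zero_iff.1 h0
    refine ⟨1, q, C z, one_pos, hq, by simp, ?_⟩
    simp [dilated, monomial_expo]
  · refine ⟨z.natAbs, u.gcd v, C z.sign * (X 0 ^ (u / u.gcd v) * X 1 ^ (v / u.gcd v)),
      Int.natAbs_pos.2 hz, hd, ?_, ?_⟩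
    · rw [mul_comm, ← Nat.gcd_mul_right]
      refine Nat.dvd_gcd ?_ ?_
      · simpa [Int.natAbs_mul] using Int.natCast_dvd.1 hu
      · simpa [Int.natAbs_mul] using Int.natCast_dvd.1 hv
    · rw [dilated, monomial_expo]
      congr 1
      simp only [map_mul, map_pow, aeval_X, aeval_C, ← pow_mul,
        Nat.mul_div_cancel' (Nat.gcd_dvd_left u v), Nat.mul_div_cancel' (Nat.gcd_dvd_right u v)]
      rw [nsmul_eq_mul, ← mul_assoc _ (algebraMap ℤ M z.sign)]
      congr 1
      conv_lhs => rw [← Int.sign_mul_natAbs z]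
      simp only [C_mul, algebraMap_eq, map_natCast, mul_comm]

end StdSym

/-- The module generated is a `ℤ`-submodule of `M ⊗ ℤ/p^b`, which is the same thing as a
`ℤ/p^b`-submodule. -/
theorem mainTheorem6 (p : ℕ) (hp : p.Prime) (a b : ℕ) (ha : 0 < a) (hab : a ≤ b)
    (m : ℕ) (hm : 0 < m) (hdvd : p ^ a ∣ m) (hndvd : ¬ p ^ (a + 1) ∣ m) :
    StdSym.H0 (CongruenceSubgroup.Gamma m) (p ^ b) =
      Submodule.span ℤ
        {f | ∃ (c d : ℕ) (P : StdSym.M), 0 < c ∧ 0 < d ∧ p ^ (b - a) ∣ c * d ∧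
          f = StdSym.dilated (p ^ b) c d P} := by
  apply le_antisymm
  · intro F hF
    obtain ⟨f, rfl⟩ := StdSym.exists_tmul_one _ F
    rw [StdSym.tmul_one_mem_H0_iff] at hF
    have hpm : (p : ℤ) ∣ m := Int.natCast_dvd_natCast.2 ((dvd_pow_self p ha.ne').trans hdvd)
    obtain ⟨n, rfl⟩ := hdvd
    -- Exactness of `a` makes the cofactor `n` of `m` cancellable mod powers of `p`.
    have hn : ¬ p ∣ n := fun h => hndvd (by rw [pow_succ]; exact mul_dvd_mul_left _ h)
    have hcop : IsCoprime ((p : ℤ) ^ (b - a)) (n : ℤ) :=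
      (Nat.isCoprime_iff_coprime.2 ((Nat.Prime.coprime_iff_not_dvd hp).2 hn)).pow_left
    have key : ∀ {i j : Fin 2}, i ≠ j → ∀ u v : ℕ,
        ((p ^ (b - a) : ℕ) : ℤ) ∣ v * MvPolynomial.coeff (StdSym.expo i j u v) f := by
      intro i j hij u v
      obtain ⟨g, hg, hgt⟩ := StdSym.transvection_mem_Gamma (p ^ a * n) hij
      have h := StdSym.dvd_mul_coeff_of_dvd_subst_transvection hp hpm hij (hgt ▸ hF g hg) u v
      rw [← Nat.add_sub_cancel' hab, pow_add, Nat.cast_mul, Nat.cast_pow, mul_assoc] at h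
      rw [Nat.cast_pow]
      exact hcop.dvd_of_dvd_mul_left
        (Int.dvd_of_mul_dvd_mul_left (pow_ne_zero _ (by exact_mod_cast hp.ne_zero)) h)
    rw [MvPolynomial.as_sum f, TensorProduct.sum_tmul]
    refine Submodule.sum_mem _ fun s _ => ?_
    obtain ⟨u, v, rfl⟩ : ∃ u v, s = StdSym.expo 0 1 u v :=
      ⟨_, _, StdSym.eq_expo (by decide) s⟩
    refine StdSym.monomial_tmul_one_mem_span (pow_pos hp.pos _) ?_ (key (by decide) u v)
    have h := key (i := 1) (j := 0) (by decide) v u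
    rwa [StdSym.expo, add_comm] at h
  · rw [Submodule.span_le]
    rintro _ ⟨c, d, P, -, -, hcd, rfl⟩
    exact StdSym.dilated_mem_H0 hp ha hab hdvd hcd P
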